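/- Let $G$ be a compact Hausdorff topological group acting continuously on a Polish space $X$. Let $E$ be an equivalence relation on $X$ which is $G$-invariant, i.e. $x_1\mathrel{E}x_2 \iff gx_1\mathrel{E}gx_2$ for all $g\in G$ and $x_1,x_2\in X$. Suppose that at least one of the following holds: - $E$ is orbital, i.e. there is a subgroup $H\le G$ such that $x_1\mathrel{E}x_2$ if and only if $x_1$ and $x_2$ lie in the same $H$-orbit; or - $E$ is weakly orbital by closed, i.e. there are a closed set $\tilde X\subseteq X$ and a (not necessarily closed) subgroup $H\le G$ such that for all $x_1,x_2\in X$ $$x_1\mathrel{E}x_2\iff \exists g\in G\ \exists h\in H\quad gx_1=hgx_2\in\tilde X .$$ Then the following are equivalent: 1. $E$ is closed, as a subset of $X\times X$; 2. each $E$-class is closed in $X$; 3. $E$ is smooth, i.e. there is a Borel function $f\colon X\to\mathbb R$ such that $x_1\mathrel{E}x_2\iff f(x_1)=f(x_2)$ (equivalently, there is a sequence $(B_n)_{n\in\mathbb N}$ of Borel subsets of $X$ such that $x_1\mathrel{E}x_2$ if and only if for all $n$ we have $x_1\in B_n\iff x_2\in B_n$); 4. for each $x\in X$, the restriction $E{\upharpoonright}_{G\cdot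 x}$ is closed, as a subset of $(G\cdot x)\times(G\cdot x)$ with the topology induced from $X\times X$. -/

import Mathlib

namespace CompactAction

/-- An equivalence relation `E` on a `G`-set is invariant when
`x₁ E x₂` if and only if `g x₁ E g x₂`, for all `g`, `x₁`, `x₂`. -/
def IsInvariant (G : Type*) {X : Type*} [Group G] [MulAction G X] (E : Setoid X) : Prop :=
  ∀ (g : G) (x₁ x₂ : X), E x₁ x₂ ↔ E (g • x₁) (g • x₂)

/-- `E` is orbital: it is the relation of lying in the same orbit of some subgroup `H` of `G`. -/
def IsOrbital (G : Type*) {X : Type*} [Group G] [MulAction G X] (E : Setoid X) : Prop :=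
  ∃ H : Subgroup G, E = MulAction.orbitRel H X

/-- The relation `R_{H, X'}`: some `g ∈ G` and `h ∈ H` satisfy `g x₁ = h g x₂ ∈ X'`. -/
def worbRel {G X : Type*} [Group G] [MulAction G X] (H : Subgroup G) (X' : Set X)
    (x₁ x₂ : X) : Prop :=
  ∃ g : G, ∃ h ∈ H, g • x₁ = h • (g • x₂) ∧ g • x₁ ∈ X'

/-- `E` is weakly orbital by closed: `E = R_{H, X'}` for some closed set `X'` and some
(arbitrary) subgroup `H` of `G`. -/
def IsWeaklyOrbitalByClosed (G : Type*) {X : Type*} [Group G] [MulAction G X]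
    [TopologicalSpace X] (E : Setoid X) : Prop :=
  ∃ (H : Subgroup G) (X' : Set X), IsClosed X' ∧ ∀ x₁ x₂ : X, E x₁ x₂ ↔ worbRel H X' x₁ x₂

/-- `E` is smooth: it is the kernel of some Borel function `f : X → ℝ`. -/
def IsSmooth {X : Type*} [TopologicalSpace X] (E : Setoid X) : Prop :=
  ∃ f : X → ℝ, @Measurable X ℝ (borel X) (borel ℝ) f ∧ ∀ x₁ x₂ : X, E x₁ x₂ ↔ f x₁ = f x₂

/-- Smoothness is the same as having a countable Borel separating family. -/
theorem isSmooth_iff_separating {X : Type*} [TopologicalSpace X] (E : Setoid X) :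
    IsSmooth E ↔ ∃ B : ℕ → Set X, (∀ n, @MeasurableSet X (borel X) (B n)) ∧
      ∀ x₁ x₂ : X, E x₁ x₂ ↔ ∀ n, (x₁ ∈ B n ↔ x₂ ∈ B n) := by
  let _ : MeasurableSpace X := borel X
  constructor
  · rintro ⟨f, hf, h⟩
    refine ⟨fun n => f ⁻¹' (MeasurableSpace.natGeneratingSequence ℝ n),
      fun n => hf (MeasurableSpace.measurableSet_natGeneratingSequence n), fun x₁ x₂ => ?_⟩
    rw [h]
    refine ⟨fun e n => by simp [e], fun e => ?_⟩
    apply MeasurableSpace.injective_mapNatBool ℝ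
    funext n
    simpa [MeasurableSpace.mapNatBool] using e n
  · rintro ⟨B, hB, h⟩
    classical
    let F : X → (ℕ → Bool) := fun x n => decide (x ∈ B n)
    have hF : Measurable F := by
      refine measurable_pi_iff.2 fun n => measurable_to_bool ?_
      have : (fun x => F x n) ⁻¹' {true} = B n := by ext x; simp [F]
      rw [this]; exact hB n
    have hemb := MeasureTheory.measurableEmbedding_embeddingReal (ℕ → Bool)
    refine ⟨fun x => MeasureTheory.embeddingReal (ℕ → Bool) (F x),
      hemb.measurable.comp hF, fun x₁ x₂ => ?_⟩
    rw [hemb.injective.eq_iff, h]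
    simp [F, funext_iff]

end CompactAction

/-! Both hypotheses on `E` reduce to the weakly orbital case, where every class lies in one
`G`-orbit. Closed classes allow `H` to be replaced by its closure, and then `E` is a projection of a
closed set along the compact `G × G`. If `E` is closed, saturations of basic open sets are Borel and
separate classes. Conversely, a Borel reduction of `E` pulls back along an orbit map to a function
on `G` whose fibres are cosets of the class stabilizer; the zero-one law, applied in the closure of
that stabilizer, forces it to be closed (`isClosed_of_coset_smooth`). -/

namespace CompactAction

open Filter Topology Set

/-! ### Baire category in compact groups -/

section ZeroOne

variable {K : Type*} [Group K] [TopologicalSpace K] [IsTopologicalGroup K] [CompactSpace K]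

/-- Topological zero-one law: in a compact group, a Borel set that is invariant under right
translation by a dense subgroup is comeager or has comeager complement. -/
theorem mem_residual_or_compl_mem_residual (S : Subgroup K) (hS : Dense (S : Set K)) {B : Set K}
    (hB : @MeasurableSet K (borel K) B) (hinv : ∀ s ∈ S, ∀ k, k * s ∈ B ↔ k ∈ B) :
    B ∈ residual K ∨ Bᶜ ∈ residual K := by
  borelize K
  obtain ⟨U, hU, hBU⟩ := hB.residualEq_isOpen
  rcases U.eq_empty_or_nonempty with rfl | ⟨u, hu⟩
  · right
    filter_upwards [hBU.mem_iff] with k hk hkB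
    exact hk.1 hkB
  left
  -- `S` may be uncountable; compactness leaves finitely many translates of `U`, so only finitely
  -- many residual conditions are intersected.
  obtain ⟨F, hF⟩ := isCompact_univ.elim_finite_subcover
    (fun s : S => (fun k : K => k * s) ⁻¹' U)
    (fun s => hU.preimage (continuous_mul_const (s : K))) (fun k _ => by
      obtain ⟨s, hsU, hs⟩ := hS.inter_open_nonempty ((fun s : K => k * s) ⁻¹' U)
        (hU.preimage (continuous_const_mul k)) ⟨k⁻¹ * u, by simpa using hu⟩
      exact mem_iUnion.2 ⟨⟨s, hs⟩, hsU⟩)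
  have key : ∀ᶠ k in residual K, ∀ s ∈ F, (k * (s : K) ∈ B ↔ k * (s : K) ∈ U) := by
    rw [Filter.eventually_all_finset]
    intro s _
    exact (tendsto_residual_of_isOpenMap (continuous_mul_const (s : K))
      (isOpenMap_mul_right (s : K))).eventually hBU.mem_iff
  filter_upwards [key] with k hk
  obtain ⟨s, hs, hks⟩ := mem_iUnion₂.1 (hF (mem_univ k))
  exact (hinv s s.2 k).1 ((hk s hs).2 hks)

/-- A dense subgroup of a compact Hausdorff group whose coset relation is smooth is everything. -/
theorem eq_top_of_dense_of_coset_smooth [T2Space K] (S : Subgroup K) (hS : Dense (S : Set K))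
    {f : K → ℝ} (hf : @Measurable K ℝ (borel K) (borel ℝ) f)
    (hfS : ∀ a b, f a = f b ↔ a⁻¹ * b ∈ S) : S = ⊤ := by
  borelize K
  let _ : MeasurableSpace ℝ := borel ℝ
  let B : ℕ → Set K := fun n => f ⁻¹' MeasurableSpace.natGeneratingSequence ℝ n
  have hBinv : ∀ n, ∀ s ∈ S, ∀ k, k * s ∈ B n ↔ k ∈ B n := fun n s hs k => by
    have : f k = f (k * s) := (hfS _ _).2 (by simpa using hs)
    simp [B, this]
  have hfB : ∀ a b, (∀ n, a ∈ B n ↔ b ∈ B n) → f a = f b := fun a b hab => by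
    apply MeasurableSpace.injective_mapNatBool ℝ
    funext n
    simpa [MeasurableSpace.mapNatBool, B] using hab n
  have hev : ∀ n, ∃ P : Prop, ∀ᶠ k in residual K, (k ∈ B n ↔ P) := fun n => by
    rcases mem_residual_or_compl_mem_residual S hS
      (hf (MeasurableSpace.measurableSet_natGeneratingSequence n)) (hBinv n) with h | h
    · exact ⟨True, by filter_upwards [h] with k hk; exact iff_true_intro hk⟩
    · exact ⟨False, by filter_upwards [h] with k hk; exact iff_false_intro hk⟩
  choose P hP using hev
  have hall : ∀ᶠ k in residual K, ∀ n, (k ∈ B n ↔ P n) := eventually_countable_forall.2 hP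
  refine (Subgroup.eq_top_iff' S).2 fun t => ?_
  -- `f` is constant on a comeager set. Taking `k`, `k * c` and `k * t * c` all in it puts both `c`
  -- and `t * c` in `S`.
  have hconj : ∃ c : K, f c = f 1 ∧ f (t * c) = f 1 := by
    obtain ⟨k, hk⟩ := (dense_of_mem_residual hall).nonempty
    have hmul : ∀ a : K, Tendsto (fun x => a * x) (residual K) (residual K) := fun a =>
      tendsto_residual_of_isOpenMap (continuous_const_mul a) (isOpenMap_mul_left a)
    obtain ⟨c, hc₁, hc₂⟩ := (dense_of_mem_residual (((hmul k).eventually hall).and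
      ((hmul (k * t)).eventually hall))).nonempty
    have h₁ : f k = f (k * c) := hfB _ _ fun n => (hk n).trans (hc₁ n).symm
    have h₂ : f k = f (k * t * c) := hfB _ _ fun n => (hk n).trans (hc₂ n).symm
    refine ⟨c, ((hfS _ _).2 ?_).symm, ((hfS _ _).2 ?_).symm⟩
    · simpa using (hfS _ _).1 h₁
    · simpa [mul_assoc] using (hfS _ _).1 h₂
  obtain ⟨c, h₁, h₂⟩ := hconj
  have hc : c ∈ S := by simpa using (hfS _ _).1 h₁.symm
  have htc : t * c ∈ S := by simpa using (hfS _ _).1 h₂.symm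
  exact (S.mul_mem_cancel_right hc).1 htc

/-- A subgroup of a compact Hausdorff group whose coset relation is smooth is closed. -/
theorem isClosed_of_coset_smooth [T2Space K] (S : Subgroup K)
    {f : K → ℝ} (hf : @Measurable K ℝ (borel K) (borel ℝ) f)
    (hfS : ∀ a b, f a = f b ↔ a⁻¹ * b ∈ S) : IsClosed (S : Set K) := by
  let C := S.topologicalClosure
  have hC : IsClosed (C : Set K) := S.isClosed_topologicalClosure
  have : CompactSpace C := isCompact_iff_compactSpace.1 hC.isCompact
  have hdense : Dense (S.subgroupOf C : Set C) := by
    rw [Subtype.dense_iff]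
    intro x hx
    have himg : ((↑) '' (S.subgroupOf C : Set C) : Set K) = S := by
      ext y
      constructor
      · rintro ⟨z, hz, rfl⟩
        exact hz
      · intro hy
        exact ⟨⟨y, S.le_topologicalClosure hy⟩, hy, rfl⟩
    exact (congrArg closure himg).symm ▸ hx
  have htop := eq_top_of_dense_of_coset_smooth (S.subgroupOf C) hdense
    (f := fun k : C => f k) (by
      borelize K
      borelize ↥C
      let _ : MeasurableSpace ℝ := borel ℝ
      exact Measurable.comp hf (continuous_subtype_val : Continuous ((↑) : C → K)).measurable)
    (fun a b => hfS a b)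
  have hSC : S = C := le_antisymm S.le_topologicalClosure (Subgroup.subgroupOf_eq_top.1 htop)
  rw [hSC]
  exact hC

end ZeroOne

/-! ### Invariant relations under compact group actions -/

section Action

variable {G X : Type*} [Group G] [MulAction G X]

theorem worbRel_mono {H H' : Subgroup G} (h : H ≤ H') {X' : Set X} {x₁ x₂ : X}
    (hx : worbRel H X' x₁ x₂) : worbRel H' X' x₁ x₂ := by
  obtain ⟨g, k, hk, hgk⟩ := hx
  exact ⟨g, k, h hk, hgk⟩

/-- Invariant orbital relations are weakly orbital by closed. -/
theorem IsOrbital.isWeaklyOrbitalByClosed [TopologicalSpace X] {E : Setoid X}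
    (hinv : IsInvariant G E) (hE : IsOrbital G E) : IsWeaklyOrbitalByClosed G E := by
  obtain ⟨H, rfl⟩ := hE
  refine ⟨H, univ, isClosed_univ, fun x₁ x₂ => ⟨?_, ?_⟩⟩
  · rintro ⟨h, hh⟩
    exact ⟨1, h, h.2, by rw [one_smul, one_smul]; exact hh.symm, mem_univ _⟩
  · rintro ⟨g, h, hh, hgh, -⟩
    -- Invariance absorbs the conjugation of `H` by `g`.
    rw [hinv g x₁ x₂]
    exact ⟨⟨h, hh⟩, hgh.symm⟩

theorem worbRel.mem_orbit {H : Subgroup G} {X' : Set X} {x₁ x₂ : X}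
    (hx : worbRel H X' x₁ x₂) : x₂ ∈ MulAction.orbit G x₁ := by
  obtain ⟨g, h, -, hgh, -⟩ := hx
  refine ⟨g⁻¹ * h⁻¹ * g, ?_⟩
  simp [mul_smul, hgh]

variable [TopologicalSpace G] [TopologicalSpace X] [ContinuousSMul G X] {E : Setoid X}

theorem isCompact_orbit [CompactSpace G] (x : X) : IsCompact (MulAction.orbit G x) :=
  isCompact_range (continuous_id.smul continuous_const)

/-- For a closed subgroup `H` of a compact group and `X'` closed, `R_{H, X'}` is closed. -/
theorem isClosed_worbRel [CompactSpace G] [T2Space X] {H : Subgroup G} (hH : IsClosed (H : Set G)) {X' : Set X}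
    (hX' : IsClosed X') : IsClosed {p : X × X | worbRel H X' p.1 p.2} := by
  let T : Set ((G × G) × (X × X)) :=
    {q | q.1.2 ∈ H ∧ q.1.1 • q.2.1 = q.1.2 • (q.1.1 • q.2.2) ∧ q.1.1 • q.2.1 ∈ X'}
  have hT : IsClosed T := by
    refine (hH.preimage (by fun_prop : Continuous fun q : (G × G) × (X × X) => q.1.2)).inter
      ((isClosed_eq ?_ ?_).inter (hX'.preimage ?_)) <;> fun_prop
  convert isClosedMap_snd_of_compactSpace T hT using 1
  ext p
  constructor
  · rintro ⟨g, h, hh, hgh, hg⟩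
    exact ⟨((g, h), p), ⟨hh, hgh, hg⟩, rfl⟩
  · rintro ⟨⟨⟨g, h⟩, p⟩, ⟨hh, hgh, hg⟩, rfl⟩
    exact ⟨g, h, hh, hgh, hg⟩

/-- If `E = R_{H, X'}` has closed classes, then passing to the closure of `H` does not change
the relation. -/
theorem rel_of_worbRel_topologicalClosure [IsTopologicalGroup G] {H : Subgroup G} {X' : Set X}
    (hE : ∀ x₁ x₂, E x₁ x₂ ↔ worbRel H X' x₁ x₂) (hcl : ∀ x, IsClosed {y | E x y}) {x₁ x₂ : X}
    (hx : worbRel H.topologicalClosure X' x₁ x₂) : E x₁ x₂ := by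
  obtain ⟨g, h, hh, hgh, hg⟩ := hx
  -- For fixed `g` and `k`, the equation `g • x₁ = k • g • y` has the unique solution `y = g⁻¹ • k⁻¹
  -- • g • x₁`, continuous in `k`.
  have hclosed : IsClosed {k : G | E x₁ (g⁻¹ • k⁻¹ • g • x₁)} :=
    (hcl x₁).preimage (by fun_prop : Continuous fun k : G => g⁻¹ • k⁻¹ • g • x₁)
  have hsub : (H : Set G) ⊆ {k : G | E x₁ (g⁻¹ • k⁻¹ • g • x₁)} := fun k hk =>
    (hE _ _).2 ⟨g, k, hk, by simp, hg⟩
  have hmem : E x₁ (g⁻¹ • h⁻¹ • g • x₁) := closure_minimal hsub hclosed hh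
  simpa [hgh] using hmem

theorem IsWeaklyOrbitalByClosed.isClosed [IsTopologicalGroup G] [CompactSpace G] [T2Space X]
    (hE : IsWeaklyOrbitalByClosed G E)
    (hcl : ∀ x, IsClosed {y | E x y}) : IsClosed {p : X × X | E p.1 p.2} := by
  obtain ⟨H, X', hX', hE⟩ := hE
  convert isClosed_worbRel H.isClosed_topologicalClosure hX' using 1
  ext p
  exact ⟨fun hp => worbRel_mono H.le_topologicalClosure ((hE _ _).1 hp),
    rel_of_worbRel_topologicalClosure hE hcl⟩

/-- Saturations of closed sets under a closed relation contained in the orbit relation of a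
compact group are closed. -/
theorem isClosed_saturation [CompactSpace G] (horb : ∀ x y, E x y → y ∈ MulAction.orbit G x)
    (hE : IsClosed {p : X × X | E p.1 p.2}) {F : Set X} (hF : IsClosed F) :
    IsClosed {x | ∃ y ∈ F, E x y} := by
  have hT : IsClosed {q : G × X | q.1 • q.2 ∈ F ∧ E q.2 (q.1 • q.2)} :=
    (hF.preimage (by fun_prop : Continuous fun q : G × X => q.1 • q.2)).inter
      (hE.preimage (by fun_prop : Continuous fun q : G × X => (q.2, q.1 • q.2)))
  convert isClosedMap_snd_of_compactSpace _ hT using 1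
  ext x
  constructor
  · rintro ⟨y, hy, hxy⟩
    obtain ⟨g, rfl⟩ := horb x y hxy
    exact ⟨(g, x), ⟨hy, hxy⟩, rfl⟩
  · rintro ⟨⟨g, x⟩, ⟨hg, hgE⟩, rfl⟩
    exact ⟨g • x, hg, hgE⟩

/-- Open sets are countable unions of closed sets and saturation commutes with unions, so
saturations of a countable basis form a Borel separating family. -/
theorem isSmooth_of_isClosed [CompactSpace G] [PolishSpace X]
    (horb : ∀ x y, E x y → y ∈ MulAction.orbit G x)
    (hE : IsClosed {p : X × X | E p.1 p.2}) : IsSmooth E := by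
  rw [isSmooth_iff_separating]
  borelize X
  have hsat : ∀ U : Set X, IsOpen U → MeasurableSet {x | ∃ y ∈ U, E x y} := fun U hU => by
    let _ := TopologicalSpace.upgradeIsCompletelyMetrizable X
    obtain ⟨F, hF, -, rfl, -⟩ := hU.exists_iUnion_isClosed
    have : {x | ∃ y ∈ ⋃ n, F n, E x y} = ⋃ n, {x | ∃ y ∈ F n, E x y} := by
      ext x
      simp only [mem_iUnion, mem_ofPred_eq]
      tauto
    rw [this]
    exact MeasurableSet.iUnion fun n => (isClosed_saturation horb hE (hF n)).measurableSet
  obtain ⟨b, hbc, -, hb⟩ := TopologicalSpace.exists_countable_basis X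
  obtain ⟨U, hU⟩ := (hbc.insert ∅).exists_eq_range (insert_nonempty _ _)
  have hUo : ∀ n, IsOpen (U n) := fun n => by
    rcases (hU ▸ mem_range_self n : U n ∈ insert ∅ b) with h | h
    · rw [h]
      exact isOpen_empty
    · exact hb.isOpen h
  refine ⟨fun n => {x | ∃ y ∈ U n, E x y}, fun n => hsat _ (hUo n), fun x₁ x₂ => ⟨?_, ?_⟩⟩
  · intro h n
    exact ⟨fun ⟨y, hy, hxy⟩ => ⟨y, hy, E.trans' (E.symm' h) hxy⟩,
      fun ⟨y, hy, hxy⟩ => ⟨y, hy, E.trans' h hxy⟩⟩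
  · intro h
    by_contra hne
    have hop : IsOpen {y | E x₂ y}ᶜ :=
      (hE.preimage (by fun_prop : Continuous fun y => (x₂, y))).isOpen_compl
    obtain ⟨V, hVb, hxV, hV⟩ := hb.exists_subset_of_mem_open
      (show x₁ ∈ {y | E x₂ y}ᶜ from fun h' => hne (E.symm' h')) hop
    obtain ⟨n, rfl⟩ : V ∈ range U := hU ▸ mem_insert_of_mem _ hVb
    obtain ⟨y, hy, hxy⟩ := (h n).1 ⟨x₁, hxV, E.refl' x₁⟩
    exact hV hy hxy

/-- The elements moving `x` within its class, under an invariant relation. -/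
def classStabilizer (hinv : IsInvariant G E) (x : X) : Subgroup G where
  carrier := {g | E x (g • x)}
  one_mem' := by simp
  mul_mem' {a b} ha hb := by
    have := (hinv a _ _).1 hb
    rw [← mul_smul] at this
    exact E.trans' ha this
  inv_mem' {a} ha := by
    have := (hinv a⁻¹ _ _).1 ha
    rw [inv_smul_smul] at this
    exact E.symm' this

/-- Smooth invariant relations contained in the orbit relation of a compact group have closed
classes. -/
theorem IsSmooth.isClosed_class [IsTopologicalGroup G] [CompactSpace G] [T2Space G] [T2Space X]
    (hinv : IsInvariant G E)
    (horb : ∀ x y, E x y → y ∈ MulAction.orbit G x) (hE : IsSmooth E) (x : X) :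
    IsClosed {y | E x y} := by
  obtain ⟨f, hf, hfE⟩ := hE
  have hcl : IsClosed (classStabilizer hinv x : Set G) := by
    refine isClosed_of_coset_smooth _ (f := fun g => f (g • x)) ?_ fun a b => ?_
    · borelize G
      borelize X
      let _ : MeasurableSpace ℝ := borel ℝ
      exact Measurable.comp hf (by fun_prop : Continuous fun g : G => g • x).measurable
    · rw [← hfE, hinv a⁻¹, inv_smul_smul, ← mul_smul]
      rfl
  convert (hcl.isCompact.image (by fun_prop : Continuous fun g : G => g • x)).isClosed using 1
  ext y
  constructor
  · intro hy
    obtain ⟨g, rfl⟩ := horb x y hy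
    exact ⟨g, hy, rfl⟩
  · rintro ⟨g, hg, rfl⟩
    exact hg

/-- The class is a slice of the restricted relation, and the orbit, being compact, is closed in `X`.
-/
theorem isClosed_class_of_isClosed_restrict_orbit [CompactSpace G] [T2Space X]
    (horb : ∀ x y, E x y → y ∈ MulAction.orbit G x) (x : X)
    (hE : IsClosed {p : MulAction.orbit G x × MulAction.orbit G x | E (p.1 : X) (p.2 : X)}) :
    IsClosed {y | E x y} := by
  have hcl : IsClosed {y : MulAction.orbit G x | E x y} :=
    hE.preimage (by fun_prop : Continuous fun y : MulAction.orbit G x =>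
      ((⟨x, MulAction.mem_orbit_self x⟩ : MulAction.orbit G x), y))
  convert (isCompact_orbit (G := G) x).isClosed.isClosedMap_subtype_val _ hcl using 1
  ext y
  constructor
  · intro hy
    exact ⟨⟨y, horb x y hy⟩, hy, rfl⟩
  · rintro ⟨z, hz, rfl⟩
    exact hz

end Action

end CompactAction

theorem mainTheorem5 {G X : Type*} [Group G] [TopologicalSpace G] [IsTopologicalGroup G]
    [CompactSpace G] [T2Space G] [TopologicalSpace X] [PolishSpace X]
    [MulAction G X] [ContinuousSMul G X] (E : Setoid X)
    (hinv : CompactAction.IsInvariant G E)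
    (hE : CompactAction.IsOrbital G E ∨ CompactAction.IsWeaklyOrbitalByClosed G E) :
    List.TFAE
      [IsClosed {p : X × X | E p.1 p.2},
       ∀ x : X, IsClosed {y : X | E x y},
       CompactAction.IsSmooth E,
       ∀ x : X, IsClosed {p : MulAction.orbit G x × MulAction.orbit G x |
         E (p.1 : X) (p.2 : X)}] := by
  have hW : CompactAction.IsWeaklyOrbitalByClosed G E :=
    hE.elim (CompactAction.IsOrbital.isWeaklyOrbitalByClosed hinv) id
  have horb : ∀ x y, E x y → y ∈ MulAction.orbit G x := by
    obtain ⟨H, X', -, h⟩ := hW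
    exact fun x y hxy => ((h x y).1 hxy).mem_orbit
  tfae_have 1 → 3 := CompactAction.isSmooth_of_isClosed horb
  tfae_have 3 → 2 := CompactAction.IsSmooth.isClosed_class hinv horb
  tfae_have 2 → 1 := hW.isClosed
  tfae_have 1 → 4 := fun h x => h.preimage
    (by fun_prop : Continuous fun p : MulAction.orbit G x × MulAction.orbit G x =>
      ((p.1 : X), (p.2 : X)))
  tfae_have 4 → 2 := fun h x =>
    CompactAction.isClosed_class_of_isClosed_restrict_orbit horb x (h x)
  tfae_finish
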